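/- Let $\zeta$ be the (analytically continued) Riemann zeta-function and let $B_n$ be the Bernoulli numbers, $\frac{Z}{e^Z-1}=\sum_{n\ge0}\frac{B_n}{n!}Z^n$. For an integer $r$ and a complex number $q$ with $|q|<1$ put $$\mathcal S_r(q)=\sum_{k=1}^\infty\sum_{l=1}^\infty\frac{q^{kl}}{l^r},$$ where the double series converges absolutely for the values of $q$ below. (i) For any integer $k\ge1$, $$\zeta(2k)=\frac{(-1)^{k+1}(2\pi)^{2k}}{2\,(2k)!}B_{2k}.$$ (ii) Let $\tau\in\mathbb C\setminus\{0\}$ with $|\arg\tau|<\pi/2$, and put $q=e^{-2\pi\tau}$ and $\hat q=e^{-2\pi/\tau}$. Then for any integer $k\ne0$ (positive or negative), $$\zeta(2k+1)+2\mathcal S_{2k+1}(q)+(2\pi)^{2k+1}\sum_{j=0}^{k+1}\frac{(-1)^jB_{2j}B_{2k+2-2j}}{(2j)!\,(2k+2-2j)!}\tau^{2k+1-2j}=(-1)^k\tau^{2k}\bigl\{\zeta(2k+1)+2\mathcal S_{2k+1}(\hat q)\bigr\},$$ where the sum over $j$ is empty if $k<-1$. -/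

import Mathlib

/-- The general term `q ^ (k l) / l ^ r` of the `q`-series `S_r(q)`, indexed by pairs `(k, l)` of
positive integers. -/
noncomputable def qSeriesTerm (r : ℤ) (q : ℂ) (p : ℕ+ × ℕ+) : ℂ :=
  q ^ ((p.1 : ℕ) * (p.2 : ℕ)) / ((p.2 : ℕ) : ℂ) ^ r

/-- The `q`-series `S_r(q) = S_r(0,0;0,0;q) = ∑_{k, l ≥ 1} q ^ (k l) / l ^ r`. -/
noncomputable def qSeries (r : ℤ) (q : ℂ) : ℂ :=
  ∑' p : ℕ+ × ℕ+, qSeriesTerm r q p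

open Complex EisensteinSeries
open UpperHalfPlane hiding I
open scoped Real Nat ModularForm ArithmeticFunction.sigma

/-! With z = iτ, the map τ ↦ 1/τ becomes z ↦ -1/z. For k = -m < 0, collecting powers of q gives
S_{1-2m}(q) = ∑ σ_{2m-1}(n) qⁿ, so ζ(1-2m) + 2S is a multiple of the Eisenstein series of weight 2m.
For m ≥ 2 the formula is its modularity; for m = 1 the correction in `G2_S_transform` supplies the
single Bernoulli term.

For k = K > 0, partial fractions of coth(πlτ) turn ζ(2K+1) + 2S into ζ(2K+2)/(πτ) plus a multiple of
the double sum of 1/(l^{2K}((lτ)² + n²)) (`zeta_add_two_mul_qSeries`). Inverting τ and swapping n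
with l preserves the quadratic form up to a factor τ², so a suitable combination of the two sums is
divisible by it and splits into products ζ(2i+2)ζ(2K-2i) (`tsum_cothTerm_sub`). Euler's formula,
also valid at ζ(0), turns these into Bernoulli products. -/

/-! ### Convergence and the rotation to the upper half-plane. -/

theorem summable_qSeriesTerm (r : ℤ) {q : ℂ} (hq : ‖q‖ < 1) : Summable (qSeriesTerm r q) := by
  refine Summable.of_norm_bounded
    (summable_prod_mul_pow (𝕜 := ℝ) r.natAbs (r := ‖q‖) (by simpa using hq)) fun p ↦ ?_
  have hl : (1 : ℝ) ≤ ((p.2 : ℕ) : ℝ) := by exact_mod_cast p.2.pos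
  rw [qSeriesTerm, norm_div, norm_pow, norm_zpow, norm_natCast, div_eq_mul_inv, mul_comm,
    ← zpow_neg]
  gcongr
  rw [← zpow_natCast]
  exact zpow_le_zpow_right₀ hl (by omega)

theorem norm_exp_neg_two_pi_mul_lt_one {τ : ℂ} (hτ : 0 < τ.re) :
    ‖cexp (-2 * (π : ℂ) * τ)‖ < 1 := by
  rw [norm_exp, Real.exp_lt_one_iff]
  have : (-2 * (π : ℂ) * τ).re = -(2 * π * τ.re) := by simp
  rw [this]
  have := Real.pi_pos
  have : 0 < 2 * π * τ.re := by positivity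
  linarith

theorem inv_re_pos {τ : ℂ} (hτ : 0 < τ.re) : 0 < (τ⁻¹).re := by
  rw [inv_re]
  exact div_pos hτ (normSq_pos.mpr (by rintro rfl; simp at hτ))

/-- The quarter turn `τ ↦ iτ` from the right half-plane to the upper half-plane. -/
noncomputable def rightHalfPlaneRotate (τ : ℂ) (hτ : 0 < τ.re) : ℍ := ⟨I * τ, by simpa using hτ⟩

theorem coe_rightHalfPlaneRotate (τ : ℂ) (hτ : 0 < τ.re) :
    (rightHalfPlaneRotate τ hτ : ℂ) = I * τ := rfl

theorem exp_rightHalfPlaneRotate {τ : ℂ} (hτ : 0 < τ.re) :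
    cexp (2 * π * I * (rightHalfPlaneRotate τ hτ : ℂ)) = cexp (-2 * (π : ℂ) * τ) := by
  rw [coe_rightHalfPlaneRotate]
  congr 1
  linear_combination (2 * (π : ℂ) * τ) * I_sq

theorem S_smul_rightHalfPlaneRotate {τ : ℂ} (hτ : 0 < τ.re) :
    ModularGroup.S • rightHalfPlaneRotate τ hτ = rightHalfPlaneRotate τ⁻¹ (inv_re_pos hτ) := by
  rw [modular_S_smul, UpperHalfPlane.ext_iff]
  simp [coe_rightHalfPlaneRotate, mul_comm]

/-! ### Negative k: Eisenstein series. -/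

theorem qSeries_eq_tsum_sigma (m : ℕ) {q : ℂ} (hq : ‖q‖ < 1) :
    qSeries (-(m : ℤ)) q = ∑' n : ℕ+, (σ m n : ℂ) * q ^ (n : ℕ) := by
  rw [← tsum_prod_pow_eq_tsum_sigma m hq, ← (summable_prod_mul_pow m hq).tsum_prod, qSeries]
  refine tsum_congr fun p ↦ ?_
  rw [qSeriesTerm, zpow_neg, zpow_natCast, div_inv_eq_mul, mul_comm]

theorem G2_rightHalfPlaneRotate {τ : ℂ} (hτ : 0 < τ.re) :
    G2 (rightHalfPlaneRotate τ hτ) =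
      2 * riemannZeta 2 - 8 * π ^ 2 * qSeries (-1) (cexp (-2 * (π : ℂ) * τ)) := by
  have := qSeries_eq_tsum_sigma 1 (norm_exp_neg_two_pi_mul_lt_one hτ)
  rw [G2_eq_tsum_cexp, exp_rightHalfPlaneRotate, ← this, Nat.cast_one]

theorem qSeries_neg_one_transform {τ : ℂ} (hτ : 0 < τ.re) :
    riemannZeta (-1) + 2 * qSeries (-1) (cexp (-2 * (π : ℂ) * τ)) + (2 * (π : ℂ) * τ)⁻¹ =
      -(τ ^ 2)⁻¹ * (riemannZeta (-1) + 2 * qSeries (-1) (cexp (-2 * (π : ℂ) * τ⁻¹))) := by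
  have h := G2_S_transform (rightHalfPlaneRotate τ hτ)
  have h0 : τ ≠ 0 := by rintro rfl; simp at hτ
  have hz : riemannZeta (-1) = -1 / 12 := by
    have := riemannZeta_neg_nat_eq_bernoulli 1
    rw [Nat.cast_one] at this
    rw [this]
    norm_num [bernoulli_two]
  have hπ : (π : ℂ) ≠ 0 := by exact_mod_cast Real.pi_ne_zero
  rw [S_smul_rightHalfPlaneRotate, G2_rightHalfPlaneRotate, G2_rightHalfPlaneRotate,
    coe_rightHalfPlaneRotate, riemannZeta_two] at h
  rw [hz]
  generalize qSeries (-1) (cexp (-2 * (π : ℂ) * τ)) = a at *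
  generalize qSeries (-1) (cexp (-2 * (π : ℂ) * τ⁻¹)) = b at *
  have h3 : -2 * (π : ℂ) * I / (I * τ) = -2 * π / τ := by
    field_simp
  rw [h3, mul_pow, I_sq] at h
  field_simp at h ⊢
  linear_combination (-(1 : ℂ)) * h

theorem riemannZeta_one_sub_two_mul (m : ℕ) (hm : m ≠ 0) :
    riemannZeta (1 - 2 * (m : ℂ)) = -bernoulli (2 * m) / (2 * m) := by
  obtain ⟨m, rfl⟩ := Nat.exists_eq_succ_of_ne_zero hm
  have := riemannZeta_neg_nat_eq_bernoulli (2 * m + 1)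
  rw [show (1 - 2 * ((m.succ : ℕ) : ℂ)) = -((2 * m + 1 : ℕ) : ℂ) by push_cast; ring, this,
    Odd.neg_one_pow ⟨m, rfl⟩, show 2 * m.succ = 2 * m + 1 + 1 by omega]
  push_cast
  ring

/-- By Euler's formula a zero would force ζ(2m) = 0, although 2m > 1. This permits clearing the
denominator B_{2m} in the q-expansion of E. -/
theorem bernoulli_two_mul_ne_zero (m : ℕ) : bernoulli (2 * m) ≠ 0 := by
  rcases eq_or_ne m 0 with rfl | hm
  · simp
  intro h
  have h1 := riemannZeta_two_mul_nat hm
  rw [h] at h1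
  refine riemannZeta_ne_zero_of_one_lt_re (s := 2 * (m : ℂ)) ?_ (by simpa using h1)
  have : (1 : ℝ) ≤ m := by exact_mod_cast Nat.one_le_iff_ne_zero.mpr hm
  have h2 : (2 * (m : ℂ)).re = 2 * m := by simp
  rw [h2]
  linarith

theorem E_rightHalfPlaneRotate {m : ℕ} (hm : 3 ≤ 2 * m) {τ : ℂ} (hτ : 0 < τ.re) :
    riemannZeta (1 - 2 * (m : ℂ)) * ModularForm.E hm (rightHalfPlaneRotate τ hτ) =
      riemannZeta (1 - 2 * (m : ℂ)) +
        2 * qSeries (1 - 2 * (m : ℤ)) (cexp (-2 * (π : ℂ) * τ)) := by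
  have h := q_expansion_bernoulli hm (even_two_mul m) (rightHalfPlaneRotate τ hτ)
  have hq := qSeries_eq_tsum_sigma (2 * m - 1) (norm_exp_neg_two_pi_mul_lt_one hτ)
  have hc : (-((2 * m - 1 : ℕ) : ℤ)) = 1 - 2 * (m : ℤ) := by omega
  simp only [exp_rightHalfPlaneRotate, zpow_natCast] at h
  rw [hc] at hq
  rw [h, ← hq, riemannZeta_one_sub_two_mul m (by omega)]
  have hb : (bernoulli (2 * m) : ℂ) ≠ 0 := by exact_mod_cast bernoulli_two_mul_ne_zero m
  have hm0 : (m : ℂ) ≠ 0 := by exact_mod_cast (by omega : m ≠ 0)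
  push_cast
  field_simp
  ring

/-- The weight factor (iτ)^{-2m} produces the sign (-1)^m. -/
theorem qSeries_one_sub_two_mul_transform {m : ℕ} (hm : 2 ≤ m) {τ : ℂ} (hτ : 0 < τ.re) :
    riemannZeta (1 - 2 * (m : ℂ)) + 2 * qSeries (1 - 2 * (m : ℤ)) (cexp (-2 * (π : ℂ) * τ)) =
      (-1) ^ m * (τ ^ (2 * m))⁻¹ * (riemannZeta (1 - 2 * (m : ℂ)) +
        2 * qSeries (1 - 2 * (m : ℤ)) (cexp (-2 * (π : ℂ) * τ⁻¹))) := by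
  have h3 : 3 ≤ 2 * m := by omega
  rw [← E_rightHalfPlaneRotate h3 hτ, ← E_rightHalfPlaneRotate h3 (inv_re_pos hτ),
    ← S_smul_rightHalfPlaneRotate hτ]
  have h : (⇑(ModularForm.E h3) ∣[((2 * m : ℕ) : ℤ)] ModularGroup.S)
      (rightHalfPlaneRotate τ hτ) = ModularForm.E h3 (rightHalfPlaneRotate τ hτ) :=
    congr_fun (SlashInvariantForm.slash_action_eqn (ModularForm.E h3)
      (Matrix.SpecialLinearGroup.mapGL ℝ ModularGroup.S) ⟨_, rfl⟩) _
  rw [← h, SlashInvariantForm.slash_S_apply, ← modular_S_smul, coe_rightHalfPlaneRotate, zpow_neg,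
    zpow_natCast, mul_pow, pow_mul I, I_sq, mul_inv, ← inv_pow, inv_neg_one]
  ring

/-! ### Positive k: partial fractions and the double series. -/

/-- Both sides are coth(πτ): the q-expansion and the Mittag-Leffler expansion of π cot(πz) are
compared at z = iτ. -/
theorem one_add_two_mul_tsum_exp {τ : ℂ} (hτ : 0 < τ.re) :
    1 + 2 * ∑' k : ℕ+, cexp (-2 * (π : ℂ) * τ) ^ (k : ℕ) =
      (π : ℂ)⁻¹ * (1 / τ + 2 * τ * ∑' n : ℕ+, 1 / (τ ^ 2 + (n : ℂ) ^ 2)) := by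
  have hq := norm_exp_neg_two_pi_mul_lt_one hτ
  have h0 : τ ≠ 0 := by rintro rfl; simp at hτ
  have hπ : (π : ℂ) ≠ 0 := by exact_mod_cast Real.pi_ne_zero
  have hgeo : 1 + ∑' k : ℕ+, cexp (-2 * (π : ℂ) * τ) ^ (k : ℕ) =
      ∑' k : ℕ, cexp (-2 * (π : ℂ) * τ) ^ k := by
    generalize cexp (-2 * (π : ℂ) * τ) = q at *
    simpa using tsum_zero_pnat_eq_tsum_nat (f := fun n ↦ q ^ n)
      (summable_geometric_of_norm_lt_one hq)
  have h1 := pi_mul_cot_pi_q_exp (rightHalfPlaneRotate τ hτ)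
  have hc := coe_mem_integerComplement (rightHalfPlaneRotate τ hτ)
  rw [coe_rightHalfPlaneRotate] at hc
  rw [exp_rightHalfPlaneRotate, coe_rightHalfPlaneRotate, cot_series_rep hc,
    ← hgeo] at h1
  have h2 : ∑' n : ℕ+, (1 / (I * τ - n) + 1 / (I * τ + n)) =
      -I * (2 * τ * ∑' n : ℕ+, 1 / (τ ^ 2 + (n : ℂ) ^ 2)) := by
    rw [← tsum_mul_left, ← tsum_mul_left]
    refine tsum_congr fun n ↦ ?_
    have ha : I * τ + n ≠ 0 := by
      simpa using integerComplement_add_ne_zero hc (n : ℤ)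
    have hb : I * τ - n ≠ 0 := by
      simpa [sub_eq_add_neg] using integerComplement_add_ne_zero hc (-(n : ℤ))
    have hab : τ ^ 2 + (n : ℂ) ^ 2 ≠ 0 := by
      have : τ ^ 2 + (n : ℂ) ^ 2 = -((I * τ + n) * (I * τ - n)) := by
        linear_combination τ ^ 2 * I_sq
      rw [this]
      exact neg_ne_zero.mpr (mul_ne_zero ha hb)
    field_simp
    linear_combination (2 * I * τ ^ 3) * I_sq
  rw [h2] at h1
  have h4 : 1 / (I * τ) = - I * (1 / τ) := by
    field_simp
    rw [I_sq, neg_neg]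
  rw [h4] at h1
  generalize ∑' n : ℕ+, 1 / (τ ^ 2 + ((n : ℕ) : ℂ) ^ 2) = A at *
  generalize ∑' k : ℕ+, cexp (-2 * (π : ℂ) * τ) ^ (k : ℕ) = B at *
  rw [← mul_right_inj' (mul_ne_zero I_ne_zero hπ), mul_assoc I, mul_assoc I,
    mul_inv_cancel_left₀ hπ]
  linear_combination h1

theorem hasSum_pnat_inv_pow {k : ℕ} (hk : 1 < k) :
    HasSum (fun n : ℕ+ ↦ (((n : ℕ) : ℂ) ^ k)⁻¹) (riemannZeta k) := by
  have hs : Summable fun n : ℕ ↦ ((n : ℂ) ^ k)⁻¹ := by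
    refine Summable.of_norm ?_
    simpa using Real.summable_nat_pow_inv.mpr hk
  have h := zeta_nat_eq_tsum_of_gt_one hk
  simp only [one_div] at h
  rw [h, ← tsum_pnat_eq_tsum_of_eq_zero (f := fun n : ℕ ↦ ((n : ℂ) ^ k)⁻¹) (by simp; omega)]
  exact (hs.comp_injective PNat.coe_injective).hasSum

theorem HasSum.mul_of_complex {ι κ : Type*} {f : ι → ℂ} {g : κ → ℂ} {a b : ℂ} (hf : HasSum f a)
    (hg : HasSum g b) : HasSum (fun p : ι × κ ↦ f p.1 * g p.2) (a * b) :=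
  hf.mul hg (summable_mul_of_summable_norm hf.summable.norm hg.summable.norm)

theorem hasSum_pnat_prod_inv_pow {a b : ℕ} (ha : 1 < a) (hb : 1 < b) :
    HasSum (fun p : ℕ+ × ℕ+ ↦ (((p.1 : ℕ) : ℂ) ^ a)⁻¹ * (((p.2 : ℕ) : ℂ) ^ b)⁻¹)
      (riemannZeta a * riemannZeta b) := by
  have h := (hasSum_pnat_inv_pow ha).mul_of_complex (hasSum_pnat_inv_pow hb)
  exact h

/-- The term `1 / (l ^ (2 K) ((l τ) ^ 2 + n ^ 2))` of the double series obtained from the partial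
fractions of `∑ coth (π l τ) / l ^ (2 K + 1)`, indexed by pairs `(n, l)`. -/
noncomputable def cothTerm (K : ℕ) (τ : ℂ) (p : ℕ+ × ℕ+) : ℂ :=
  (((p.2 : ℕ) : ℂ) ^ (2 * K))⁻¹ * (1 / ((((p.2 : ℕ) : ℂ) * τ) ^ 2 + ((p.1 : ℕ) : ℂ) ^ 2))

theorem exists_le_norm_sq_add_sq {τ : ℂ} (hτ : 0 < τ.re) :
    ∃ c : ℝ, 0 < c ∧ ∀ n l : ℕ+,
      c * ((n : ℕ) : ℝ) ^ 2 ≤ ‖(((l : ℕ) : ℂ) * τ) ^ 2 + ((n : ℕ) : ℂ) ^ 2‖ := by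
  set z := rightHalfPlaneRotate τ hτ with hz
  refine ⟨r z * r z, mul_pos (r_pos z) (r_pos z), fun n l ↦ ?_⟩
  have hn : ((n : ℕ) : ℂ) ≠ 0 := by simp
  have h1 := auxbound2 z (((l : ℕ) : ℝ) / ((n : ℕ) : ℝ)) (d := 1) (by simp)
  have h2 := auxbound2 z (((l : ℕ) : ℝ) / ((n : ℕ) : ℝ)) (d := -1) (by simp)
  have h3 := mul_le_mul h1 h2 (r_pos z).le (norm_nonneg _)
  rw [← norm_mul, hz, coe_rightHalfPlaneRotate] at h3
  -- Over ℂ the form factors as -(l·iτ + n)(l·iτ - n); after dividing by n, each factor has norm at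
  -- least `r z`.
  have h4 : (((l : ℕ) : ℂ) * τ) ^ 2 + ((n : ℕ) : ℂ) ^ 2 =
      -(((((l : ℕ) : ℝ) / ((n : ℕ) : ℝ) : ℝ) * (I * τ) + (1 : ℝ)) *
        ((((l : ℕ) : ℝ) / ((n : ℕ) : ℝ) : ℝ) * (I * τ) + (-1 : ℝ))) * ((n : ℕ) : ℂ) ^ 2 := by
    push_cast
    field_simp
    linear_combination (((l : ℕ) : ℂ) ^ 2 * τ ^ 2) * I_sq
  rw [h4, norm_mul, norm_neg, norm_pow, norm_natCast]
  gcongr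

theorem sq_add_sq_ne_zero {τ : ℂ} (hτ : 0 < τ.re) (n l : ℕ+) :
    (((l : ℕ) : ℂ) * τ) ^ 2 + ((n : ℕ) : ℂ) ^ 2 ≠ 0 := by
  obtain ⟨c, hc, h⟩ := exists_le_norm_sq_add_sq hτ
  have hn : (0 : ℝ) < ((n : ℕ) : ℝ) := by exact_mod_cast n.pos
  exact norm_pos_iff.mp (lt_of_lt_of_le (by positivity) (h n l))

/-- The bound c·n² on the denominator gives no decay in l, so l^{-2K} must provide it; hence K ≠ 0.
-/
theorem summable_cothTerm {K : ℕ} (hK : K ≠ 0) {τ : ℂ} (hτ : 0 < τ.re) :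
    Summable (cothTerm K τ) := by
  obtain ⟨c, hc, h⟩ := exists_le_norm_sq_add_sq hτ
  have hs (k : ℕ) (hk : 1 < k) : Summable fun n : ℕ+ ↦ ((((n : ℕ) : ℝ) ^ k)⁻¹) :=
    (Real.summable_nat_pow_inv.mpr hk).comp_injective PNat.coe_injective
  refine Summable.of_norm_bounded
    (((hs 2 one_lt_two).mul_of_nonneg (hs (2 * K) (by omega)) (fun _ ↦ by positivity)
      (fun _ ↦ by positivity)).mul_left c⁻¹) fun p ↦ ?_
  have hn : (0 : ℝ) < ((p.1 : ℕ) : ℝ) := by exact_mod_cast p.1.pos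
  rw [cothTerm, norm_mul, norm_inv, norm_pow, norm_natCast, one_div, norm_inv]
  calc _ ≤ (((p.2 : ℕ) : ℝ) ^ (2 * K))⁻¹ * (c * ((p.1 : ℕ) : ℝ) ^ 2)⁻¹ := by
        gcongr
        exact h _ _
    _ = _ := by
        rw [mul_inv]
        ring

theorem tsum_prod_swap {f : ℕ+ × ℕ+ → ℂ} (hf : Summable f) :
    ∑' p, f p = ∑' l, ∑' n, f (n, l) := by
  rw [← (Equiv.prodComm ℕ+ ℕ+).tsum_eq f]
  exact ((Equiv.prodComm ℕ+ ℕ+).summable_iff.mpr hf).tsum_prod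

theorem zeta_add_two_mul_qSeries {K : ℕ} (hK : K ≠ 0) {τ : ℂ} (hτ : 0 < τ.re) :
    riemannZeta (2 * (K : ℂ) + 1) + 2 * qSeries (2 * (K : ℤ) + 1) (cexp (-2 * (π : ℂ) * τ)) =
      (π : ℂ)⁻¹ * (riemannZeta (2 * (K : ℂ) + 2) / τ + 2 * τ * ∑' p, cothTerm K τ p) := by
  have hq := norm_exp_neg_two_pi_mul_lt_one hτ
  have h0 : τ ≠ 0 := by rintro rfl; simp at hτ
  have hs := summable_qSeriesTerm (2 * (K : ℤ) + 1) hq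
  have hs' : Summable fun l ↦ ∑' n,
      qSeriesTerm (2 * (K : ℤ) + 1) (cexp (-2 * (π : ℂ) * τ)) (n, l) :=
    ((Equiv.prodComm ℕ+ ℕ+).summable_iff.mpr hs).prod
  have ht := summable_cothTerm hK hτ
  have ht' : Summable fun l ↦ ∑' n, cothTerm K τ (n, l) :=
    ((Equiv.prodComm ℕ+ ℕ+).summable_iff.mpr ht).prod
  have hz1 := hasSum_pnat_inv_pow (k := 2 * K + 1) (by omega)
  have hz2 := hasSum_pnat_inv_pow (k := 2 * K + 2) (by omega)
  push_cast at hz1 hz2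
  rw [qSeries, tsum_prod_swap hs, tsum_prod_swap ht, ← hz1.tsum_eq, ← hz2.tsum_eq,
    ← tsum_mul_left, ← hz1.summable.tsum_add (hs'.mul_left 2), ← tsum_div_const,
    ← tsum_mul_left, ← (hz2.summable.div_const τ).tsum_add (ht'.mul_left (2 * τ)),
    ← tsum_mul_left]
  refine tsum_congr fun l ↦ ?_
  have hl : ((l : ℕ) : ℂ) ≠ 0 := by simp
  have hlτ : 0 < (((l : ℕ) : ℂ) * τ).re := by
    have : (0 : ℝ) < ((l : ℕ) : ℝ) := by exact_mod_cast l.pos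
    simpa using mul_pos this hτ
  have h := one_add_two_mul_tsum_exp hlτ
  have e1 : ∑' n : ℕ+, qSeriesTerm (2 * (K : ℤ) + 1) (cexp (-2 * (π : ℂ) * τ)) (n, l) =
      (((l : ℕ) : ℂ) ^ (2 * K + 1))⁻¹ *
        ∑' n : ℕ+, cexp (-2 * (π : ℂ) * (((l : ℕ) : ℂ) * τ)) ^ (n : ℕ) := by
    rw [← tsum_mul_left]
    refine tsum_congr fun n ↦ ?_
    rw [qSeriesTerm, div_eq_inv_mul, ← exp_nat_mul, ← exp_nat_mul]
    have e : (((l : ℕ) : ℂ) ^ (2 * (K : ℤ) + 1)) = ((l : ℕ) : ℂ) ^ (2 * K + 1) := by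
      exact_mod_cast zpow_natCast ((l : ℕ) : ℂ) (2 * K + 1)
    rw [e]
    congr 2
    push_cast
    ring
  have e2 : ∑' n : ℕ+, cothTerm K τ (n, l) = (((l : ℕ) : ℂ) ^ (2 * K))⁻¹ *
        ∑' n : ℕ+, 1 / ((((l : ℕ) : ℂ) * τ) ^ 2 + ((n : ℕ) : ℂ) ^ 2) := by
    rw [← tsum_mul_left]
    rfl
  rw [e1, e2]
  generalize ∑' n : ℕ+, cexp (-2 * (π : ℂ) * (((l : ℕ) : ℂ) * τ)) ^ (n : ℕ) = A at *
  generalize ∑' n : ℕ+, 1 / ((((l : ℕ) : ℂ) * τ) ^ 2 + ((n : ℕ) : ℂ) ^ 2) = B at *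
  have hπ : (π : ℂ) ≠ 0 := by exact_mod_cast Real.pi_ne_zero
  rw [show (((l : ℕ) : ℂ) ^ (2 * K + 1))⁻¹ + 2 * ((((l : ℕ) : ℂ) ^ (2 * K + 1))⁻¹ * A) =
    (((l : ℕ) : ℂ) ^ (2 * K + 1))⁻¹ * (1 + 2 * A) by ring, h]
  field_simp
  ring

theorem cothTerm_inv_swap (K : ℕ) {τ : ℂ} (hτ : τ ≠ 0) (p : ℕ+ × ℕ+) :
    cothTerm K τ⁻¹ p.swap = τ ^ 2 * ((((p.1 : ℕ) : ℂ) ^ (2 * K))⁻¹ *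
      (1 / ((((p.2 : ℕ) : ℂ) * τ) ^ 2 + ((p.1 : ℕ) : ℂ) ^ 2))) := by
  rw [cothTerm, Prod.fst_swap, Prod.snd_swap]
  have h : (((p.1 : ℕ) : ℂ) * τ⁻¹) ^ 2 + ((p.2 : ℕ) : ℂ) ^ 2 =
      ((((p.2 : ℕ) : ℂ) * τ) ^ 2 + ((p.1 : ℕ) : ℂ) ^ 2) / τ ^ 2 := by
    field_simp
    ring
  rw [h, one_div_div]
  ring

/-- This is the factorisation of y^K - (-xt)^K by y + xt, divided by (xy)^K. It is used with x = l²,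
y = n², t = τ². -/
theorem inv_pow_sub_mul_div_add (K : ℕ) {x y t : ℂ} (hx : x ≠ 0) (hy : y ≠ 0)
    (hxy : x * t + y ≠ 0) :
    ((x ^ K)⁻¹ - (-1) ^ K * t ^ K * (y ^ K)⁻¹) * (1 / (x * t + y)) =
      ∑ i ∈ Finset.range K, (-1) ^ (K - 1 - i) * t ^ (K - 1 - i) * (x ^ (i + 1))⁻¹ *
        (y ^ (K - i))⁻¹ := by
  rw [mul_one_div, div_eq_iff hxy]
  have h := geom_sum₂_mul y (-(x * t)) K
  have h1 : (x ^ K)⁻¹ - (-1) ^ K * t ^ K * (y ^ K)⁻¹ =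
      (y ^ K - (-(x * t)) ^ K) * ((x ^ K)⁻¹ * (y ^ K)⁻¹) := by
    rw [neg_pow (x * t), mul_pow]
    field_simp
  rw [h1, ← h, sub_neg_eq_add, add_comm y, mul_right_comm, Finset.sum_mul]
  congr 1
  refine Finset.sum_congr rfl fun i hi ↦ ?_
  rw [Finset.mem_range] at hi
  obtain ⟨j, rfl⟩ : ∃ j, K = i + j + 1 := ⟨K - 1 - i, by omega⟩
  rw [show i + j + 1 - 1 - i = j by omega, show i + j + 1 - i = j + 1 by omega,
    neg_pow (x * t), mul_pow]
  field_simp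
  ring

theorem tsum_cothTerm_sub {K : ℕ} (hK : K ≠ 0) {τ : ℂ} (hτ : 0 < τ.re) :
    τ ^ 2 * ∑' p, cothTerm K τ p - (-1) ^ K * (τ ^ 2) ^ K * ∑' p, cothTerm K τ⁻¹ p =
      τ ^ 2 * ∑ i ∈ Finset.range K, (-1) ^ (K - 1 - i) * (τ ^ 2) ^ (K - 1 - i) *
        (riemannZeta (2 * (i + 1 : ℕ)) * riemannZeta (2 * (K - i : ℕ))) := by
  have h0 : τ ≠ 0 := by rintro rfl; simp at hτ
  have ht := (summable_cothTerm hK hτ).hasSum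
  have ht' := (summable_cothTerm hK (inv_re_pos hτ)).hasSum
  rw [← (Equiv.prodComm ℕ+ ℕ+).hasSum_iff] at ht'
  refine ((ht.mul_left (τ ^ 2)).sub (ht'.mul_left ((-1) ^ K * (τ ^ 2) ^ K))).unique ?_
  have hsum : ∀ i ∈ Finset.range K, HasSum (fun p : ℕ+ × ℕ+ ↦
      (-1) ^ (K - 1 - i) * (τ ^ 2) ^ (K - 1 - i) * ((((p.2 : ℕ) : ℂ) ^ (2 * (i + 1)))⁻¹ *
        (((p.1 : ℕ) : ℂ) ^ (2 * (K - i)))⁻¹))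
      ((-1) ^ (K - 1 - i) * (τ ^ 2) ^ (K - 1 - i) *
        (riemannZeta (2 * (i + 1 : ℕ)) * riemannZeta (2 * (K - i : ℕ)))) := by
    intro i hi
    rw [Finset.mem_range] at hi
    have h3 := hasSum_pnat_prod_inv_pow (a := 2 * (K - i)) (b := 2 * (i + 1)) (by omega) (by omega)
    rw [Nat.cast_mul, Nat.cast_mul, Nat.cast_two, mul_comm (riemannZeta _)] at h3
    refine (h3.mul_left _).congr_fun fun p ↦ ?_
    rw [mul_comm (_)⁻¹]
  refine ((hasSum_sum hsum).mul_left (τ ^ 2)).congr_fun fun p ↦ ?_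
  have hx : ((p.2 : ℕ) : ℂ) ≠ 0 := by simp
  have hy : ((p.1 : ℕ) : ℂ) ≠ 0 := by simp
  have hxy := sq_add_sq_ne_zero hτ p.1 p.2
  rw [mul_pow] at hxy
  have h := inv_pow_sub_mul_div_add K (pow_ne_zero 2 hx) (pow_ne_zero 2 hy) hxy
  simp only [← pow_mul] at h
  simp only [Function.comp_apply, Equiv.prodComm_apply, ← pow_mul, ← mul_assoc] at h ⊢
  rw [cothTerm_inv_swap K h0, cothTerm, ← h, mul_pow _ τ]
  ring

/-! ### From zeta products to Bernoulli products. -/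

theorem bernoulli_mul_bernoulli_eq_zeta_mul_zeta (a b : ℕ) :
    (2 * (π : ℂ)) ^ (2 * a + 2 * b) *
        (bernoulli (2 * a) * bernoulli (2 * b) / (((2 * a)! : ℂ) * ((2 * b)! : ℂ))) =
      4 * (-1) ^ (a + b) * (riemannZeta (2 * a) * riemannZeta (2 * b)) := by
  have h2 (m : ℕ) : (2 : ℂ) ^ (2 * (m : ℤ) - 1) = 2 ^ (2 * m) / 2 := by
    rw [zpow_sub_one₀ two_ne_zero, div_eq_mul_inv]
    exact_mod_cast rfl
  have hs (m : ℕ) : (-1 : ℂ) ^ m * (-1) ^ m = 1 := by rw [← mul_pow]; simp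
  rw [riemannZeta_two_mul_nat', riemannZeta_two_mul_nat', h2, h2]
  simp only [mul_pow, pow_add, div_eq_mul_inv, mul_inv]
  linear_combination (-(2 : ℂ) ^ (2 * a) * π ^ (2 * a) * 2 ^ (2 * b) * π ^ (2 * b) *
    bernoulli (2 * a) * bernoulli (2 * b) * ((2 * a)! : ℂ)⁻¹ * ((2 * b)! : ℂ)⁻¹) *
      ((-1) ^ b * (-1) ^ b * hs a + hs b)

theorem bernoulli_term_eq_zeta_term {K j : ℕ} (hj : j ≤ K + 1) {τ : ℂ} :
    (2 * (π : ℂ)) ^ (2 * K + 1) * ((-1) ^ j * bernoulli (2 * j) * bernoulli (2 * (K + 1 - j)) /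
        (((2 * j)! : ℂ) * ((2 * (K + 1 - j))! : ℂ)) * τ ^ (2 * (K : ℤ) + 1 - 2 * j)) =
      2 * (π : ℂ)⁻¹ * (-1) ^ (K + 1 + j) * (riemannZeta (2 * j) * riemannZeta (2 * (K + 1 - j : ℕ)))
        * τ ^ (2 * (K : ℤ) + 1 - 2 * j) := by
  have hπ : (π : ℂ) ≠ 0 := by exact_mod_cast Real.pi_ne_zero
  have h := bernoulli_mul_bernoulli_eq_zeta_mul_zeta j (K + 1 - j)
  rw [show 2 * j + 2 * (K + 1 - j) = 2 * K + 1 + 1 by omega, pow_succ,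
    show j + (K + 1 - j) = K + 1 by omega] at h
  rw [pow_add _ (K + 1)]
  have hc := mul_inv_cancel₀ hπ
  generalize (2 * (π : ℂ)) ^ (2 * K + 1) = X at *
  generalize riemannZeta (2 * j) * riemannZeta (2 * (K + 1 - j : ℕ)) = Z at *
  linear_combination ((-1) ^ j * τ ^ (2 * (K : ℤ) + 1 - 2 * j) * (π : ℂ)⁻¹ / 2) * h -
    (X * ((-1) ^ j * bernoulli (2 * j) * bernoulli (2 * (K + 1 - j)) /
        (((2 * j)! : ℂ) * ((2 * (K + 1 - j))! : ℂ)) * τ ^ (2 * (K : ℤ) + 1 - 2 * j))) * hc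

theorem qSeries_two_mul_add_one_transform {K : ℕ} (hK : K ≠ 0) {τ : ℂ} (hτ : 0 < τ.re) :
    riemannZeta (2 * (K : ℂ) + 1) + 2 * qSeries (2 * (K : ℤ) + 1) (cexp (-2 * (π : ℂ) * τ)) +
        (2 * (π : ℂ)) ^ (2 * K + 1) * ∑ j ∈ Finset.range (K + 2),
          (-1) ^ j * bernoulli (2 * j) * bernoulli (2 * (K + 1 - j)) /
            (((2 * j)! : ℂ) * ((2 * (K + 1 - j))! : ℂ)) * τ ^ (2 * (K : ℤ) + 1 - 2 * j) =
      (-1) ^ K * τ ^ (2 * K) * (riemannZeta (2 * (K : ℂ) + 1) +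
        2 * qSeries (2 * (K : ℤ) + 1) (cexp (-2 * (π : ℂ) * τ⁻¹))) := by
  have h0 : τ ≠ 0 := by rintro rfl; simp at hτ
  rw [Finset.mul_sum, Finset.sum_congr rfl fun j hj ↦ bernoulli_term_eq_zeta_term
    (by rw [Finset.mem_range] at hj; omega), Finset.sum_range_succ, Finset.sum_range_succ',
    zeta_add_two_mul_qSeries hK hτ, zeta_add_two_mul_qSeries hK (inv_re_pos hτ)]
  -- The end terms j = 0 and j = K + 1 contain ζ(0) = -1/2 and account for the two ζ(2K+2) terms;
  -- the rest match `tsum_cothTerm_sub`.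
  have hmid : ∑ i ∈ Finset.range K, 2 * (π : ℂ)⁻¹ * (-1) ^ (K + 1 + (i + 1)) *
      (riemannZeta (2 * (i + 1 : ℕ)) * riemannZeta (2 * (K + 1 - (i + 1) : ℕ))) *
        τ ^ (2 * (K : ℤ) + 1 - 2 * (i + 1 : ℕ)) =
      -(2 * (π : ℂ)⁻¹ * τ * ∑ i ∈ Finset.range K, (-1) ^ (K - 1 - i) * (τ ^ 2) ^ (K - 1 - i) *
        (riemannZeta (2 * (i + 1 : ℕ)) * riemannZeta (2 * (K - i : ℕ)))) := by
    rw [Finset.mul_sum, ← Finset.sum_neg_distrib]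
    refine Finset.sum_congr rfl fun i hi ↦ ?_
    rw [Finset.mem_range] at hi
    obtain ⟨m, rfl⟩ : ∃ m, K = i + m + 1 := ⟨K - 1 - i, by omega⟩
    rw [show i + m + 1 - 1 - i = m by omega, show i + m + 1 + 1 - (i + 1) = i + m + 1 - i by omega,
      show (2 * ((i + m + 1 : ℕ) : ℤ) + 1 - 2 * (i + 1 : ℕ)) = ((2 * m + 1 : ℕ) : ℤ) by
        push_cast; ring, zpow_natCast,
      show i + m + 1 + 1 + (i + 1) = m + 1 + 2 * (i + 1) by omega, pow_add _ (m + 1), pow_mul _ 2]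
    norm_num
    ring
  have hsub := tsum_cothTerm_sub hK hτ
  rw [hmid]
  generalize ∑ i ∈ Finset.range K, (-1) ^ (K - 1 - i) * (τ ^ 2) ^ (K - 1 - i) *
        (riemannZeta (2 * (i + 1 : ℕ)) * riemannZeta (2 * (K - i : ℕ))) = M at *
  generalize ∑' p, cothTerm K τ p = A at *
  generalize ∑' p, cothTerm K τ⁻¹ p = B at *
  rw [Nat.sub_self, Nat.cast_zero, mul_zero, riemannZeta_zero, Nat.sub_zero, Nat.cast_zero,
    mul_zero, sub_zero, add_zero,
    show 2 * ((K + 1 : ℕ) : ℂ) = 2 * (K : ℂ) + 2 by push_cast; ring,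
    show 2 * (K : ℤ) + 1 - 2 * ((K + 1 : ℕ) : ℤ) = -1 by push_cast; ring, zpow_neg_one,
    show 2 * (K : ℤ) + 1 = ((2 * K + 1 : ℕ) : ℤ) by push_cast; ring, zpow_natCast,
    ← two_mul (K + 1), pow_mul _ 2]
  have hs : ((-1 : ℂ) ^ 2) ^ (K + 1) = 1 := by norm_num
  rw [hs]
  have hsub' : τ * A - (-1) ^ K * (τ ^ 2) ^ K * τ⁻¹ * B = τ * M := by
    field_simp
    linear_combination hsub
  rw [pow_mul τ 2, pow_succ τ, pow_mul τ 2, div_inv_eq_mul]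
  linear_combination (2 * (π : ℂ)⁻¹) * hsub'

/-! ### Assembly of the cases. -/

theorem re_pos_of_abs_arg_lt {τ : ℂ} (h0 : τ ≠ 0) (h : |τ.arg| < π / 2) : 0 < τ.re :=
  (abs_arg_lt_pi_div_two_iff.mp h).resolve_right h0

theorem corollary4p5 :
    -- Euler's formula
    (∀ k : ℕ, 1 ≤ k →
      riemannZeta (2 * (k : ℂ)) =
        (-1 : ℂ) ^ (k + 1) * (2 * (Real.pi : ℂ)) ^ (2 * k) / (2 * ((2 * k).factorial : ℂ))
          * (bernoulli (2 * k) : ℂ)) ∧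
    -- Ramanujan's formula; the sum over `j` runs over `0 ≤ j ≤ k + 1`, and is empty if `k < -1`
    (∀ k : ℤ, k ≠ 0 → ∀ τ : ℂ, τ ≠ 0 → |τ.arg| < Real.pi / 2 →
      ∀ q q' : ℂ, q = Complex.exp (-2 * (Real.pi : ℂ) * τ) →
        q' = Complex.exp (-2 * (Real.pi : ℂ) / τ) →
      Summable (qSeriesTerm (2 * k + 1) q) ∧
      Summable (qSeriesTerm (2 * k + 1) q') ∧
      riemannZeta (2 * (k : ℂ) + 1) + 2 * qSeries (2 * k + 1) q
          + (2 * (Real.pi : ℂ)) ^ (2 * k + 1)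
            * ∑ j ∈ Finset.Icc (0 : ℤ) (k + 1),
                (-1 : ℂ) ^ j
                  * (bernoulli (2 * j).toNat : ℂ) * (bernoulli (2 * k + 2 - 2 * j).toNat : ℂ)
                  / (((2 * j).toNat.factorial : ℂ) * ((2 * k + 2 - 2 * j).toNat.factorial : ℂ))
                  * τ ^ (2 * k + 1 - 2 * j)
        = (-1 : ℂ) ^ k * τ ^ (2 * k)
            * (riemannZeta (2 * (k : ℂ) + 1) + 2 * qSeries (2 * k + 1) q')) := by
  constructor
  · intro k hk
    obtain ⟨m, rfl⟩ := Nat.exists_eq_add_of_le' hk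
    rw [riemannZeta_two_mul_nat (by omega), show 2 * (m + 1) - 1 = 2 * m + 1 by omega, mul_pow]
    field_simp
    ring
  · rintro k hk τ h0 harg q q' rfl rfl
    have hτ := re_pos_of_abs_arg_lt h0 harg
    rw [div_eq_mul_inv]
    refine ⟨summable_qSeriesTerm _ (norm_exp_neg_two_pi_mul_lt_one hτ),
      summable_qSeriesTerm _ (norm_exp_neg_two_pi_mul_lt_one (inv_re_pos hτ)), ?_⟩
    rcases lt_trichotomy k 0 with hneg | h | hpos
    · obtain ⟨m, rfl⟩ : ∃ m : ℕ, k = -(m : ℤ) := ⟨k.natAbs, by omega⟩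
      have hz : 2 * ((-(m : ℤ) : ℤ) : ℂ) + 1 = 1 - 2 * (m : ℂ) := by push_cast; ring
      rw [hz, show 2 * -(m : ℤ) + 1 = 1 - 2 * (m : ℤ) by ring]
      rcases (show m = 1 ∨ 2 ≤ m by omega) with rfl | hm
      -- For k = -1 only j = 0 remains, contributing (2π)⁻¹τ⁻¹.
      · have h := qSeries_neg_one_transform hτ
        norm_num at h ⊢
        rw [← h]
        ring
      · have h := qSeries_one_sub_two_mul_transform hm hτ
        rw [Finset.Icc_eq_empty (by omega), Finset.sum_empty, mul_zero, add_zero, h,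
          show 2 * -(m : ℤ) = -((2 * m : ℕ) : ℤ) by push_cast; ring, zpow_neg τ, zpow_natCast,
          zpow_neg, ← inv_zpow, inv_neg_one, zpow_natCast]
    · exact absurd h hk
    · obtain ⟨K, rfl⟩ : ∃ K : ℕ, k = (K : ℤ) := ⟨k.natAbs, by omega⟩
      have h := qSeries_two_mul_add_one_transform (K := K) (by omega) hτ
      -- Since 0 ≤ j ≤ K + 1, neither `toNat` truncates.
      have hsum : ∑ j ∈ Finset.Icc (0 : ℤ) ((K : ℤ) + 1), (-1 : ℂ) ^ j
          * (bernoulli (2 * j).toNat : ℂ) * (bernoulli (2 * (K : ℤ) + 2 - 2 * j).toNat : ℂ)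
          / (((2 * j).toNat ! : ℂ) * ((2 * (K : ℤ) + 2 - 2 * j).toNat ! : ℂ))
          * τ ^ (2 * (K : ℤ) + 1 - 2 * j) = ∑ j ∈ Finset.range (K + 2),
          (-1) ^ j * bernoulli (2 * j) * bernoulli (2 * (K + 1 - j)) /
            (((2 * j)! : ℂ) * ((2 * (K + 1 - j))! : ℂ)) * τ ^ (2 * (K : ℤ) + 1 - 2 * j) := by
        symm
        refine Finset.sum_nbij (fun j : ℕ ↦ (j : ℤ)) ?_ ?_ ?_ ?_
        · intro j hj
          simp only [Finset.mem_range, Finset.mem_Icc] at hj ⊢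
          omega
        · exact fun _ _ _ _ h ↦ Nat.cast_injective h
        · intro j hj
          simp only [Finset.coe_Icc, Set.mem_Icc, Finset.coe_range, Set.mem_image,
            Set.mem_Iio] at hj ⊢
          exact ⟨j.toNat, by omega, by omega⟩
        · intro j hj
          rw [Finset.mem_range] at hj
          rw [show (2 * (j : ℤ)).toNat = 2 * j by omega,
            show (2 * (K : ℤ) + 2 - 2 * j).toNat = 2 * (K + 1 - j) by omega, zpow_natCast]
      rw [hsum, Int.cast_natCast, zpow_natCast, show 2 * (K : ℤ) = ((2 * K : ℕ) : ℤ) by simp,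
        zpow_natCast, show ((2 * K : ℕ) : ℤ) + 1 = ((2 * K + 1 : ℕ) : ℤ) by simp, zpow_natCast]
      push_cast
      exact h
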